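/- Let $\kappa$ be an infinite cardinal and let $S$ be a set of cardinality $\kappa$. Order the partitions of $S$ by refinement ($P\le Q$ iff each block of $P$ is a subset of a block of $Q$); this gives a bounded lattice, whose least element $\bot$ is the partition into singletons and whose greatest element is $\top=\{S\}$. For a partition $P$ of $S$, let $\mathrm{compl}(P)$ be the set of complements of $P$ in this lattice, i.e. the set of partitions $Q$ of $S$ with $P\vee Q=\top$ and $P\wedge Q=\bot$, and let $|P|$ be the number of blocks of $P$. Let $P\notin\{\bot,\top\}$ be a partition of $S$. Then (1) $\kappa\le|\mathrm{compl}(P)|\le 2^{\kappa}$. (2) $|\mathrm{compl}(P)|\ge 2^{|P|}$. (3) If $P$ contains no block of cardinality $\kappa$, then $|\mathrm{compl}(P)|=2^{\kappa}$. (4) If $P$ contains a block $\bar B$ of cardinality $\kappa$, then $|\mathrm{compl}(P)|=\kappa^{|S\setminus\bar B|}$. (5) If $P$ contains two or more blocks of cardinality $\kappa$, then $|\mathrm{compl}(P)|=2^{\kappa}$. -/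

import Mathlib

open Cardinal

/-- The order of Mathlib's lattice `Setoid.Partitions S` of partitions of `S` is refinement:
`P ≤ Q` iff each block of `P` is a subset of a block of `Q`. -/
theorem partitions_le_iff_refines {S : Type*} (P Q : Setoid.Partitions S) :
    P ≤ Q ↔ ∀ B ∈ P.toSet, ∃ C ∈ Q.toSet, B ⊆ C := by
  constructor
  · intro h B hB
    obtain ⟨x, hx⟩ := Setoid.nonempty_of_mem_partition P.isPartition hB
    obtain ⟨C, ⟨hC, hxC⟩, -⟩ := Q.isPartition.2 x
    refine ⟨C, hC, fun y hy => ?_⟩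
    have hxy : Setoid.mkClasses P.toSet P.isPartition.2 x y := by
      intro s hs hxs
      rwa [(P.isPartition.2 x).unique ⟨hs, hxs⟩ ⟨hB, hx⟩]
    exact h hxy C hC hxC
  · intro h x y hxy s hs hxs
    obtain ⟨B, ⟨hB, hxB⟩, -⟩ := P.isPartition.2 x
    obtain ⟨C, hC, hBC⟩ := h B hB
    rw [(Q.isPartition.2 x).unique ⟨hs, hxs⟩ ⟨hC, hBC hxB⟩]
    exact hBC (hxy B hB hxB)

/-- The set of complements of the partition `P` in the lattice of all partitions of `S`. -/
def partitionCompl {S : Type*} (P : Setoid.Partitions S) : Set (Setoid.Partitions S) :=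
  {Q | P ⊔ Q = ⊤ ∧ P ⊓ Q = ⊥}

/-! Partitions are handled as equivalence relations. If a block `B` has size κ, each class of a
complement meets `B` in at most one point, so representatives can be chosen that fix `B`; this
leaves at most κ^|Bᶜ| complements, and the κ^|Bᶜ| injections `Bᶜ ↪ B` give as many.

If every block is smaller than κ, take a transversal `T`. When |T| = κ, gluing each representative
outside one block to either of two points of that block gives 2^κ complements. Otherwise |Tᶜ| = κ,
and a maximal matching of inequivalent points of `Tᶜ` has at least κ pairs; `T` together with any
subset of these pairs gives a complement. The remaining claims are cardinal arithmetic. -/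

theorem Setoid.isCompl_of_base {S : Type*} {r q : Setoid S} (a : S)
    (hinf : ∀ x y, r x y → q x y → x = y) (hsup : ∀ x, (r ⊔ q) x a) : IsCompl r q := by
  refine IsCompl.of_eq ?_ ?_
  · exact eq_bot_iff.2 fun {x y} h => hinf x y h.1 h.2
  · exact Setoid.eq_top_iff.2 fun x y => (r ⊔ q).trans' (hsup x) ((r ⊔ q).symm' (hsup y))

theorem Setoid.sup_of_left {S : Type*} {r q : Setoid S} {x y : S} (h : r x y) : (r ⊔ q) x y :=
  (le_sup_left : r ≤ r ⊔ q) h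

theorem Setoid.sup_of_right {S : Type*} {r q : Setoid S} {x y : S} (h : q x y) : (r ⊔ q) x y :=
  (le_sup_right : q ≤ r ⊔ q) h

theorem Setoid.eq_of_isCompl {S : Type*} {r q : Setoid S} (h : IsCompl r q) {x y : S}
    (hr : r x y) (hq : q x y) : x = y := by
  have : (r ⊓ q) x y := ⟨hr, hq⟩
  rwa [h.inf_eq_bot] at this

/-- An infinite type `S` has at most `2 ^ #S` equivalence relations. -/
theorem Cardinal.mk_setoid_le {S : Type*} (hS : ℵ₀ ≤ #S) : #(Setoid S) ≤ 2 ^ #S := by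
  have h : Function.Injective (fun q : Setoid S => {p : S × S | q p.1 p.2}) := by
    intro q q' hq
    ext x y
    exact Set.ext_iff.1 hq (x, y)
  calc #(Setoid S) ≤ #(Set (S × S)) := mk_le_of_injective h
    _ = 2 ^ #S := by rw [mk_set, ← mul_def, mul_eq_self hS]

/-- Gluing every point outside of a block `B` to a point of `B`, injectively, gives
a complement. -/
theorem Setoid.power_le_mk_isCompl {S : Type*} (hS : ℵ₀ ≤ #S) (r : Setoid S) {B : Set S}
    (hB : B ∈ r.classes) (hc : #B = #S) : #S ^ #(Bᶜ : Set S) ≤ #{q | IsCompl r q} := by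
  classical
  obtain ⟨b, rfl⟩ := hB
  set B : Set S := {x | r x b} with hBdef
  have : Infinite B := by rw [infinite_iff, hc]; exact hS
  have hemb : #(↥Bᶜ ↪ B) = #S ^ #(Bᶜ : Set S) := by
    rw [mk_embedding_eq_arrow_of_le (by rw [hc]; exact mk_set_le _), ← power_def, hc]
  rw [← hemb]
  let g : (↥Bᶜ ↪ B) → S → S := fun f x => if hx : x ∈ B then x else f ⟨x, hx⟩
  have gin : ∀ f x, x ∈ B → g f x = x := fun f x hx => dif_pos hx
  have gout : ∀ f (x : ↥Bᶜ), g f x = f x := fun f x => dif_neg x.2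
  have gB : ∀ f x, g f x ∈ B := by
    intro f x
    by_cases hx : x ∈ B
    · rwa [gin f x hx]
    · rw [gout f ⟨x, hx⟩]; exact (f _).2
  have hcompl : ∀ f, IsCompl r (Setoid.ker (g f)) := by
    intro f
    refine Setoid.isCompl_of_base b ?_ ?_
    · intro x y hr hq
      rw [Setoid.ker_def] at hq
      by_cases hx : x ∈ B
      · have hy : y ∈ B := r.trans' (r.symm' hr) hx
        rwa [gin f x hx, gin f y hy] at hq
      · have hy : y ∉ B := fun hy => hx (r.trans' hr hy)
        rw [gout f ⟨x, hx⟩, gout f ⟨y, hy⟩] at hq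
        exact congrArg Subtype.val (f.injective (Subtype.ext hq))
    · intro x
      refine (r ⊔ _).trans' (y := g f x) (Setoid.sup_of_right ?_) (Setoid.sup_of_left (gB f x))
      rw [Setoid.ker_def, gin f _ (gB f x)]
  refine mk_le_of_injective (f := fun f => ⟨Setoid.ker (g f), hcompl f⟩) ?_
  intro f f' hff
  have hker : Setoid.ker (g f) = Setoid.ker (g f') := congrArg Subtype.val hff
  ext x
  have h1 : Setoid.ker (g f) x (f x) := by
    rw [Setoid.ker_def, gin f _ (f x).2, gout]
  rw [hker, Setoid.ker_def, gin f' _ (f x).2, gout] at h1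
  exact h1.symm

/-- A complement is determined by a choice of representatives that is the identity on a block. -/
theorem Setoid.mk_isCompl_le_power {S : Type*} (r : Setoid S) {B : Set S}
    (hB : B ∈ r.classes) : #{q | IsCompl r q} ≤ #S ^ #(Bᶜ : Set S) := by
  obtain ⟨b, rfl⟩ := hB
  set B : Set S := {x | r x b} with hBdef
  -- A class of `q` contains at most one point of `B`; that point, if any, is its representative.
  have key : ∀ q : {q | IsCompl r q}, ∃ g : S → S, Setoid.ker g = q.1 ∧ ∀ x ∈ B, g x = x := by
    rintro ⟨q, hq⟩
    have hrep : ∀ c : Quotient q, ∃ x, Quotient.mk q x = c ∧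
        ∀ y ∈ B, Quotient.mk q y = c → y = x := by
      intro c
      by_cases h : ∃ x ∈ B, Quotient.mk q x = c
      · obtain ⟨x, hx, hxc⟩ := h
        exact ⟨x, hxc, fun y hy hyc => Setoid.eq_of_isCompl hq (r.trans' hy (r.symm' hx))
          (Quotient.exact (hyc.trans hxc.symm))⟩
      · exact ⟨c.out, c.out_eq, fun y hy hyc => (h ⟨y, hy, hyc⟩).elim⟩
    choose F hF hFB using hrep
    refine ⟨fun x => F (Quotient.mk q x), ?_, fun x hx => (hFB _ x hx rfl).symm⟩
    ext x y
    rw [Setoid.ker_def]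
    constructor
    · intro h
      have := congrArg (Quotient.mk q) h
      rw [hF, hF] at this
      exact Quotient.exact this
    · intro h
      exact congrArg F (Quotient.sound h)
  choose g hg hgB using key
  rw [power_def]
  refine mk_le_of_injective (f := fun q (x : ↥Bᶜ) => g q x) ?_
  intro q q' h
  have hgg : g q = g q' := by
    funext x
    by_cases hx : x ∈ B
    · rw [hgB q x hx, hgB q' x hx]
    · exact congrFun h ⟨x, hx⟩
  exact Subtype.ext (by rw [← hg q, ← hg q', hgg])

/-- Splitting a transversal in two parts, glued to two distinct points of the same block, gives
a complement. -/
theorem Setoid.two_power_mk_quotient_le {S : Type*} (r : Setoid S) (hr : r ≠ ⊥)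
    (hinf : ℵ₀ ≤ #(Quotient r)) : 2 ^ #(Quotient r) ≤ #{q | IsCompl r q} := by
  classical
  obtain ⟨a, b, hab, hne⟩ : ∃ a b, r a b ∧ a ≠ b := by
    by_contra! h
    exact hr (eq_bot_iff.2 fun {x y} hxy => h x y hxy)
  let out : S → S := fun x => (Quotient.mk r x).out
  have hout : ∀ x, r x (out x) := fun x => r.symm' (Quotient.mk_out x)
  have hout2 : ∀ {x y}, r x y → out x = out y := fun {x y} h => by
    simp only [out, Quotient.sound h]
  have : Infinite (Quotient r) := infinite_iff.2 hinf
  -- The block of `a` is never moved, so it carries no choice.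
  let C : Set (Quotient r) := {Quotient.mk r a}ᶜ
  have hC : #C = #(Quotient r) := by
    refine mk_compl_of_infinite _ ?_
    rw [mk_singleton]
    exact one_lt_aleph0.trans_le hinf
  rw [← hC, ← mk_powerset]
  let g : Set (Quotient r) → S → S := fun X x =>
    if r x a then x else if x = out x then (if Quotient.mk r x ∈ X then a else b) else x
  have g1 : ∀ X x, r x a → g X x = x := fun X x h => if_pos h
  have g2 : ∀ X x, ¬ r x a → x ≠ out x → g X x = x := fun X x h h' => by
    simp only [g, if_neg h, if_neg h']
  have g3 : ∀ X x, ¬ r x a → x = out x → g X x = if Quotient.mk r x ∈ X then a else b :=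
    fun X x h h' => by simp only [g, if_neg h]; exact if_pos h'
  have g4 : ∀ X x, ¬ r x a → x = out x → r (g X x) a := fun X x h h' => by
    rw [g3 X x h h']
    split_ifs
    · exact r.refl' a
    · exact r.symm' hab
  have hcompl : ∀ X, IsCompl r (Setoid.ker (g X)) := by
    intro X
    refine Setoid.isCompl_of_base a ?_ ?_
    · intro x y hxy hq
      rw [Setoid.ker_def] at hq
      by_cases hx : r x a
      · rwa [g1 X x hx, g1 X y (r.trans' (r.symm' hxy) hx)] at hq
      · have hy : ¬ r y a := fun hy => hx (r.trans' hxy hy)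
        by_cases hxo : x = out x <;> by_cases hyo : y = out y
        · rw [hxo, hyo, hout2 hxy]
        · rw [g2 X y hy hyo] at hq
          exact (hy (hq ▸ g4 X x hx hxo)).elim
        · rw [g2 X x hx hxo] at hq
          exact (hx (hq ▸ g4 X y hy hyo)).elim
        · rwa [g2 X x hx hxo, g2 X y hy hyo] at hq
    · intro x
      by_cases hx : r x a
      · exact Setoid.sup_of_left hx
      · have hox : ¬ r (out x) a := fun h => hx (r.trans' (hout x) h)
        have hoo : out x = out (out x) := hout2 (hout x)
        refine (r ⊔ _).trans' (Setoid.sup_of_left (hout x)) ?_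
        refine (r ⊔ _).trans' (y := g X (out x)) (Setoid.sup_of_right ?_)
          (Setoid.sup_of_left (g4 X _ hox hoo))
        rw [Setoid.ker_def, g1 X _ (g4 X _ hox hoo)]
  refine mk_le_of_injective (f := fun X : 𝒫 C => ⟨Setoid.ker (g X.1), hcompl X.1⟩) ?_
  rintro ⟨X, hX⟩ ⟨Y, hY⟩ hXY
  have hker : Setoid.ker (g X) = Setoid.ker (g Y) := congrArg Subtype.val hXY
  -- The set is recovered from the kernel: its members are the blocks whose representative is glued
  -- to `a` rather than `b`.
  have hmem : ∀ Z ⊆ C, ∀ c, c ∈ Z ↔ c ∈ C ∧ Setoid.ker (g Z) c.out a := by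
    intro Z hZ c
    refine ⟨fun h => ⟨hZ h, ?_⟩, fun ⟨hc, h⟩ => ?_⟩
    all_goals
      have hca : ¬ r c.out a := fun h' => by
        have hcC : c ∈ C := by first | exact hc | exact hZ h
        exact hcC (by rw [Set.mem_singleton_iff, ← c.out_eq]; exact Quotient.sound h')
      have hco : c.out = out c.out := by simp only [out, Quotient.out_eq]
    · rw [Setoid.ker_def, g1 Z a (r.refl' a), g3 Z _ hca hco, Quotient.out_eq, if_pos h]
    · rw [Setoid.ker_def, g1 Z a (r.refl' a), g3 Z _ hca hco, Quotient.out_eq] at h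
      by_contra hcZ
      rw [if_neg hcZ] at h
      exact hne h.symm
  exact Subtype.ext (Set.ext fun c => by rw [hmem X hX, hmem Y hY, hker])

/-- If a set `A` is larger than every block of `r`, then there are `#A` disjoint pairs of
inequivalent elements of `A`. -/
theorem Setoid.exists_matching {S : Type*} (r : Setoid S) (A : Set S) (hA : ℵ₀ ≤ #A)
    (hlt : ∀ B ∈ r.classes, #B < #A) :
    ∃ M : Set (S × S), #A ≤ #M ∧ (∀ p ∈ M, p.1 ∈ A ∧ p.2 ∈ A ∧ ¬ r p.1 p.2) ∧
      ∀ p ∈ M, ∀ q ∈ M, (p.1 = q.1 ∨ p.1 = q.2 ∨ p.2 = q.1 ∨ p.2 = q.2) → p = q := by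
  obtain ⟨M, ⟨hM1, hM2⟩, hmax⟩ := zorn_subset
    {M : Set (S × S) | (∀ p ∈ M, p.1 ∈ A ∧ p.2 ∈ A ∧ ¬ r p.1 p.2) ∧
      ∀ p ∈ M, ∀ q ∈ M, (p.1 = q.1 ∨ p.1 = q.2 ∨ p.2 = q.1 ∨ p.2 = q.2) → p = q} (by
    intro c hc hchain
    refine ⟨⋃₀ c, ⟨?_, ?_⟩, fun s hs => Set.subset_sUnion_of_mem hs⟩
    · rintro p ⟨s, hs, hp⟩
      exact (hc hs).1 p hp
    · rintro p ⟨s, hs, hp⟩ q ⟨t, ht, hq⟩ h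
      rcases hchain.total hs ht with hst | hst
      · exact (hc ht).2 p (hst hp) q hq h
      · exact (hc hs).2 p hp q (hst hq) h)
  refine ⟨M, ?_, hM1, hM2⟩
  -- The endpoints of a smaller matching, plus one block, could not exhaust `A`, so another pair
  -- could be added.
  by_contra! hlt'
  let U : Set S := Prod.fst '' M ∪ Prod.snd '' M
  have hU : #U < #A := (mk_union_le _ _).trans_lt
    (add_lt_of_lt hA (mk_image_le.trans_lt hlt') (mk_image_le.trans_lt hlt'))
  obtain ⟨x, hxA, hxU⟩ : ∃ x ∈ A, x ∉ U := by
    by_contra! h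
    exact hU.not_ge (mk_le_mk_of_subset h)
  have hV : #(U ∪ {y | r y x} : Set S) < #A :=
    (mk_union_le _ _).trans_lt (add_lt_of_lt hA hU (hlt _ ⟨x, rfl⟩))
  obtain ⟨y, hyA, hyV⟩ : ∃ y ∈ A, y ∉ U ∪ {y | r y x} := by
    by_contra! h
    exact hV.not_ge (mk_le_mk_of_subset h)
  have hyU : y ∉ U := fun h => hyV (Or.inl h)
  have hxy : ¬ r x y := fun h => hyV (Or.inr (r.symm' h))
  have hU1 : ∀ p ∈ M, p.1 ∈ U := fun p hp => Or.inl ⟨p, hp, rfl⟩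
  have hU2 : ∀ p ∈ M, p.2 ∈ U := fun p hp => Or.inr ⟨p, hp, rfl⟩
  have hmem : (x, y) ∈ M := by
    refine hmax (y := insert (x, y) M) ⟨?_, ?_⟩ (Set.subset_insert _ _) (Set.mem_insert _ _)
    · rintro p (rfl | hp)
      · exact ⟨hxA, hyA, hxy⟩
      · exact hM1 p hp
    · rintro p (rfl | hp) q (rfl | hq) h
      · rfl
      · have := hU1 q hq
        have := hU2 q hq
        grind
      · have := hU1 p hp
        have := hU2 p hp
        grind
      · exact hM2 p hp q hq h
  exact hxU (hU1 _ hmem)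

/-- A transversal, as one block, together with any disjoint pairs of inequivalent elements outside
of the transversal, gives a complement. -/
theorem Setoid.two_power_mk_matching_le {S : Type*} [Nonempty S] (r : Setoid S) (M : Set (S × S))
    (hM1 : ∀ p ∈ M, p.1 ∈ (Set.range (Quotient.out : Quotient r → S))ᶜ ∧
      p.2 ∈ (Set.range (Quotient.out : Quotient r → S))ᶜ ∧ ¬ r p.1 p.2)
    (hM2 : ∀ p ∈ M, ∀ q ∈ M, (p.1 = q.1 ∨ p.1 = q.2 ∨ p.2 = q.1 ∨ p.2 = q.2) → p = q) :
    2 ^ #M ≤ #{q | IsCompl r q} := by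
  set T : Set S := Set.range (Quotient.out : Quotient r → S) with hT
  have hTr : ∀ {x y}, x ∈ T → y ∈ T → r x y → x = y := by
    rintro _ _ ⟨c, rfl⟩ ⟨d, rfl⟩ h
    have : c = d := by rw [← c.out_eq, ← d.out_eq]; exact Quotient.sound h
    rw [this]
  let q : 𝒫 M → Setoid S := fun X =>
    { r := fun x y => x = y ∨ (x ∈ T ∧ y ∈ T) ∨ (x, y) ∈ X.1 ∨ (y, x) ∈ X.1
      iseqv := by
        have h1 : ∀ x y, (x, y) ∈ X.1 → x ∉ T ∧ y ∉ T :=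
          fun x y h => ⟨(hM1 _ (X.2 h)).1, (hM1 _ (X.2 h)).2.1⟩
        have h2 : ∀ x y z w, (x, y) ∈ X.1 → (z, w) ∈ X.1 →
            (x = z ∨ x = w ∨ y = z ∨ y = w) → x = z ∧ y = w :=
          fun x y z w h h' e => Prod.ext_iff.1 (hM2 _ (X.2 h) _ (X.2 h') e)
        refine ⟨fun x => Or.inl rfl, ?_, ?_⟩
        · intro x y h
          grind
        · intro x y z h h'
          grind }
  have hq : ∀ X x y, q X x y ↔ x = y ∨ (x ∈ T ∧ y ∈ T) ∨ (x, y) ∈ X.1 ∨ (y, x) ∈ X.1 :=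
    fun X x y => Iff.rfl
  obtain ⟨a⟩ := ‹Nonempty S›
  have hcompl : ∀ X, IsCompl r (q X) := by
    intro X
    refine Setoid.isCompl_of_base (Quotient.mk r a).out ?_ ?_
    · intro x y hxy h
      rcases (hq X x y).1 h with h | h | h | h
      · exact h
      · exact hTr h.1 h.2 hxy
      · exact ((hM1 _ (X.2 h)).2.2 hxy).elim
      · exact ((hM1 _ (X.2 h)).2.2 (r.symm' hxy)).elim
    · intro x
      refine (r ⊔ _).trans' (y := (Quotient.mk r x).out)
        (Setoid.sup_of_left (r.symm' (Quotient.mk_out x))) (Setoid.sup_of_right ?_)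
      exact (hq X _ _).2 (Or.inr (Or.inl ⟨⟨_, rfl⟩, ⟨_, rfl⟩⟩))
  rw [← mk_powerset]
  refine mk_le_of_injective (f := fun X => ⟨q X, hcompl X⟩) ?_
  intro X Y hXY
  have hqq : q X = q Y := congrArg Subtype.val hXY
  have hmem : ∀ Z : 𝒫 M, ∀ p, p ∈ Z.1 ↔ p ∈ M ∧ q Z p.1 p.2 := by
    rintro Z ⟨x, y⟩
    refine ⟨fun h => ⟨Z.2 h, (hq Z _ _).2 (Or.inr (Or.inr (Or.inl h)))⟩, fun ⟨hp, h⟩ => ?_⟩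
    obtain ⟨h1, -, h3⟩ := hM1 _ hp
    rcases (hq Z x y).1 h with h | h | h | h
    · exact (h3 (h ▸ r.refl' _)).elim
    · exact (h1 h.1).elim
    · exact h
    -- A pair and its reverse share a point, hence are equal.
    · have := hM2 _ hp _ (Z.2 h) (Or.inr (Or.inl rfl))
      rwa [this]
  exact Subtype.ext (Set.ext fun p => by rw [hmem X, hmem Y, hqq])

/-- Since `S` is infinite, a transversal or its complement has full size; each case has its own
construction. -/
theorem Setoid.two_power_le_of_classes_lt {S : Type*} (hS : ℵ₀ ≤ #S) (r : Setoid S) (hr : r ≠ ⊥)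
    (hlt : ∀ B ∈ r.classes, #B < #S) : 2 ^ #S ≤ #{q | IsCompl r q} := by
  have : Infinite S := infinite_iff.2 hS
  let T : Set S := Set.range (Quotient.out : Quotient r → S)
  have hT : #T = #(Quotient r) := mk_range_eq _ Quotient.out_injective
  rcases (mk_set_le T).lt_or_eq with h | h
  · have hTc : #(Tᶜ : Set S) = #S := mk_compl_of_infinite T h
    obtain ⟨M, hM, hM1, hM2⟩ := r.exists_matching Tᶜ (by rwa [hTc]) (by rwa [hTc])
    exact (power_le_power_left two_ne_zero (hTc ▸ hM)).trans
      (r.two_power_mk_matching_le M hM1 hM2)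
  · have hQ : #(Quotient r) = #S := hT.symm.trans h
    have := r.two_power_mk_quotient_le hr (by rwa [hQ])
    rwa [hQ] at this

theorem mk_partitionCompl_orderIso {S : Type*} (r : Setoid S) :
    #(partitionCompl (Setoid.Partition.orderIso S r)) = #{q | IsCompl r q} := by
  refine (mk_congr ((Setoid.Partition.orderIso S).toEquiv.subtypeEquiv fun q => ?_)).symm
  change IsCompl r q ↔ _ ⊔ Setoid.Partition.orderIso S q = ⊤ ∧
    _ ⊓ Setoid.Partition.orderIso S q = ⊥
  rw [(Setoid.Partition.orderIso S).isCompl_iff, isCompl_iff, disjoint_iff, codisjoint_iff,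
    and_comm]

theorem mainTheorem1 {S : Type*} (κ : Cardinal) (hκ : ℵ₀ ≤ κ) (hS : #S = κ)
    (P : Setoid.Partitions S) (hbot : P ≠ ⊥) (htop : P ≠ ⊤) :
    (κ ≤ #(partitionCompl P) ∧ #(partitionCompl P) ≤ 2 ^ κ) ∧
    2 ^ #P.toSet ≤ #(partitionCompl P) ∧
    ((∀ B ∈ P.toSet, #B ≠ κ) → #(partitionCompl P) = 2 ^ κ) ∧
    (∀ B ∈ P.toSet, #B = κ → #(partitionCompl P) = κ ^ #(Bᶜ : Set S)) ∧
    ((∃ B₁ ∈ P.toSet, ∃ B₂ ∈ P.toSet, B₁ ≠ B₂ ∧ #B₁ = κ ∧ #B₂ = κ) →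
      #(partitionCompl P) = 2 ^ κ) := by
  subst hS
  obtain ⟨r, rfl⟩ := (Setoid.Partition.orderIso S).surjective P
  have hr : r ≠ ⊥ := fun h => hbot (by rw [h, map_bot])
  have hr' : r ≠ ⊤ := fun h => htop (by rw [h, map_top])
  have hset : (Setoid.Partition.orderIso S r).toSet = r.classes := rfl
  rw [mk_partitionCompl_orderIso, hset]
  have upper : #{q | IsCompl r q} ≤ 2 ^ #S := (mk_set_le _).trans (mk_setoid_le hκ)
  have h3 : (∀ B ∈ r.classes, #B ≠ #S) → #{q | IsCompl r q} = 2 ^ #S := fun h =>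
    upper.antisymm (r.two_power_le_of_classes_lt hκ hr
      fun B hB => lt_of_le_of_ne (mk_set_le B) (h B hB))
  have h4 : ∀ B ∈ r.classes, #B = #S → #{q | IsCompl r q} = #S ^ #(Bᶜ : Set S) :=
    fun B hB hc => (r.mk_isCompl_le_power hB).antisymm (r.power_le_mk_isCompl hκ hB hc)
  have hne : ∀ B ∈ r.classes, #(Bᶜ : Set S) ≠ 0 := by
    rintro _ ⟨b, rfl⟩ h
    rw [mk_eq_zero_iff, Set.isEmpty_coe_sort, Set.compl_empty_iff, Set.eq_univ_iff_forall] at h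
    exact hr' (Setoid.eq_top_iff.2 fun x y => r.trans' (h x) (r.symm' (h y)))
  have hclass : #r.classes ≤ #S := by
    have : r.classes = Set.range fun y => {x | r x y} := by
      ext s
      simp only [Setoid.classes, Set.mem_ofPred_eq, Set.mem_range, eq_comm]
    rw [this]
    exact mk_range_le
  -- Every block other than `B` has a point outside `B`; the 1 counts `B` itself.
  have hcompl_le : ∀ B ∈ r.classes, #r.classes ≤ #(Bᶜ : Set S) + 1 := by
    intro B hB
    have hsub : r.classes ⊆ insert B (Set.range fun y : ↥Bᶜ => {x | r x y}) := by
      rintro _ ⟨y, rfl⟩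
      by_cases hy : y ∈ B
      · exact Or.inl (Setoid.eq_of_mem_classes (r.mem_classes y) (r.refl' y) hB hy)
      · exact Or.inr ⟨⟨y, hy⟩, rfl⟩
    exact (mk_le_mk_of_subset hsub).trans (mk_insert_le.trans (by gcongr; exact mk_range_le))
  refine ⟨⟨?_, upper⟩, ?_, h3, h4, ?_⟩
  · by_cases h : ∃ B ∈ r.classes, #B = #S
    · obtain ⟨B, hB, hc⟩ := h
      rw [h4 B hB hc]
      exact self_le_power _ (Cardinal.one_le_iff_ne_zero.2 (hne B hB))
    · push Not at h
      rw [h3 h]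
      exact (cantor _).le
  · by_cases h : ∃ B ∈ r.classes, #B = #S
    · obtain ⟨B, hB, hc⟩ := h
      rw [h4 B hB hc]
      refine (power_le_power_left two_ne_zero (hcompl_le B hB)).trans ?_
      have h2 : (2 : Cardinal) ≤ #S := (ofNat_lt_aleph0 (n := 2)).le.trans hκ
      -- For finite `Bᶜ` the left side is finite; for infinite `Bᶜ` the extra 1 is absorbed.
      rcases lt_or_ge #(Bᶜ : Set S) ℵ₀ with hfin | hinf
      · refine le_trans ?_ (self_le_power _ (Cardinal.one_le_iff_ne_zero.2 (hne B hB)))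
        exact (power_lt_aleph0 ofNat_lt_aleph0
          (add_lt_aleph0 hfin one_lt_aleph0)).le.trans hκ
      · rw [add_one_eq hinf]
        exact power_le_power_right h2
    · push Not at h
      rw [h3 h]
      exact power_le_power_left two_ne_zero hclass
  · rintro ⟨B₁, hB₁, B₂, hB₂, hne12, hc₁, hc₂⟩
    rw [h4 B₁ hB₁ hc₁]
    have hsub : B₂ ⊆ B₁ᶜ := fun x hx hx' =>
      hne12 (Setoid.eq_of_mem_classes hB₁ hx' hB₂ hx)
    have : #(B₁ᶜ : Set S) = #S :=
      (mk_set_le _).antisymm (hc₂ ▸ mk_le_mk_of_subset hsub)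
    rw [this, power_self_eq hκ]
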